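/- **Setting.** Consider a finite two-player zero-sum extensive-form game with chance in which both players have perfect recall. Let $\mathcal Z$ be the set of terminal histories, $u_i$ the utility of player $i$, $\mathcal S_i$ the (finite) set of information states of player $i$, each of which is a nonempty set of histories, and $\mathcal A(s)$ the set of actions available at $s$; put $|\mathcal A_i|=\max_{s\in\mathcal S_i}|\mathcal A(s)|$ (and $|\mathcal A_i|=0$ if $\mathcal S_i=\emptyset$) and $\Delta_{u_i}=\max_{z,z'\in\mathcal Z}(u_i(z)-u_i(z'))$. A policy $\pi_i$ assigns to each $s\in\mathcal S_i$ a point $\pi_i(s)$ of the simplex $\Delta_s$ of probability distributions on $\mathcal A(s)$; $v_{i,\pi}$ is the expected utility of player $i$ under the joint policy $\pi$; $\delta_i(\pi)=\max_{\pi_i'}v_{i,(\pi_i',\pi_{-i})}-v_{i,\pi}$; and $\pi$ is an $\varepsilon$-Nash equilibrium if $\max_i\delta_i(\pi)\le\varepsilon$. The counterfactual values are $q^c_{i,\pi}(s,a)=\sum_{h\in s}\eta_{-i,\pi}(h)\,q_{i,\pi}(h,a)$, where $\eta_{-i,\pi}(h)$ is the contribution of the opponent and chance to the probability of reaching $h$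 and $q_{i,\pi}(h,a)$ is the expected utility of $i$ when $\pi$ is played from the history $ha$. **Algorithms.** *TabularED$(q^c,\ell_2)$* with learning rates $(\alpha^t)_{t\ge1}$ starts from an arbitrary joint policy $\pi^0$. In iteration $t\ge1$ it computes, for each player $i$, a best response $b_i^t$ to $\pi_{-i}^{t-1}$ (any best response may be chosen), and then sets, for each player $i$ and each $s\in\mathcal S_i$, $$\pi_i^t(s)=\Pi_{\ell_2}\bigl(\pi_i^{t-1}(s)+\alpha^t q^{c,b}(s)\bigr),\qquad q^{c,b}(s)=\bigl(q^c_{i,(\pi_i^{t-1},b_{-i}^t)}(s,a)\bigr)_{a\in\mathcal A(s)},$$ where $\Pi_{\ell_2}$ is the Euclidean projection on $\Delta_s$. *GIGA* with step sizes $(\alpha^t)$ on a decision set $F$, against cost functions $c^1,c^2,\dots$, plays an arbitrary $x^1\in F$ and then $x^{t+1}=\Pi_F(x^t-\alpha^t\nabla c^t(x^t))$. *CFR-BR(GIGA)* with joint policies $\sigma^1,\sigma^2,\dots$ computes, in iteration $t\ge1$ and for each player $i$, a best response $b_i^t$ to $\sigma^t_{-i}$; the policy $\sigma_i^t(s)$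 at each $s\in\mathcal S_i$ is the $t$-th decision of a separate copy of GIGA on $\Delta_s$, which faces the costs $c^t(x)=-\sum_a x_a\,q^c_{i,(\sigma_i^t,b_{-i}^t)}(s,a)$. **Theorem.** 1. For all learning rates, TabularED$(q^c,\ell_2)$ coincides with CFR-BR(GIGA): sequences $(\pi^t)_{t\ge0}$, $(b^t)_{t\ge1}$ are a run of TabularED$(q^c,\ell_2)$ with learning rates $(\alpha^t)$ if and only if $\sigma^t=\pi^{t-1}$ and $b^t$ $(t\ge1)$ are a run of CFR-BR(GIGA) with step sizes $(\alpha^t)$. 2. Let $\alpha^t=t^{-1/2}$. For every run of TabularED$(q^c,\ell_2)$, each player $i$ and each $T\ge1$, some policy $\pi_i^*\in\{\pi_i^1,\dots,\pi_i^T\}$ is $i$'s part of a $\frac{2\varepsilon}{T}$-Nash equilibrium, where $$\varepsilon=|\mathcal S_i|\Bigl(\sqrt T+\bigl(\sqrt T-\tfrac12\bigr)|\mathcal A_i|\,(\Delta_{u_i})^2\Bigr).$$ Every best iterate, that is, every $\pi_i^t$ with $1\le t\le T$ for which the value $v_{i,(\pi_i^t,b_{-i}^{t+1})}$ against the opponent's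 best response is largest, is such a $\pi_i^*$. 3. In the situation of 2, $\frac{2\varepsilon}{T}\to0$ as $T\to\infty$, and the best iterate converges to equilibrium: if for each $T\ge1$ the policy $\hat\pi_i^T$ is a best iterate among the first $T$, then for every $\delta>0$ and all sufficiently large $T$, $\hat\pi_i^T$ is $i$'s part of a $\delta$-Nash equilibrium, and there is a Nash equilibrium $\sigma$ with $\|\hat\pi_i^T(s)-\sigma_i(s)\|_2<\delta$ for all $s\in\mathcal S_i$. -/

import Mathlib

/-!
Finite two-player extensive-form games with chance and imperfect information, tabular exploitability
descent with counterfactual values and Euclidean projection, and CFR-BR with GIGA as local learner.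

A history is the list of the actions played so far, with the most recent action at the head. Thus
`a :: h` is the history `h` followed by `a`, and "`h` is a prefix of `z`" is `h <:+ z`.
-/

open Filter Topology

/-- A finite extensive-form game with the two players `0`, `1` and chance.
`Act` is the type of actions (chance outcomes included), `Info` the type of information states. -/
structure ExtensiveGame (Act Info : Type*) [Fintype Act] [DecidableEq Act] where
  /-- the finite set of histories -/
  hist : Finset (List Act)
  root_mem : [] ∈ hist
  prefix_mem : ∀ (a : Act) (h : List Act), a :: h ∈ hist → h ∈ hist
  /-- the information state of a nonterminal history; `none` means that chance moves -/
  infoAt : List Act → Option Info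
  /-- the player whose turn it is at an information state -/
  player : Info → Fin 2
  /-- the actions available at an information state -/
  avail : Info → Finset Act
  mem_avail : ∀ h ∈ hist, (∃ a, a :: h ∈ hist) → ∀ s, infoAt h = some s →
    ∀ a, a ∈ avail s ↔ a :: h ∈ hist
  /-- every information state is a nonempty set of (nonterminal) histories -/
  info_nonempty : ∀ s, ∃ h ∈ hist, (∃ a, a :: h ∈ hist) ∧ infoAt h = some s
  /-- the fixed stochastic policy of chance -/
  chance : List Act → Act → ℝ
  chance_nonneg : ∀ h ∈ hist, infoAt h = none → ∀ a, a :: h ∈ hist → 0 ≤ chance h a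
  chance_sum : ∀ h ∈ hist, (∃ a, a :: h ∈ hist) → infoAt h = none →
    ∑ a with a :: h ∈ hist, chance h a = 1
  /-- the utilities; only the values at terminal histories matter -/
  utility : Fin 2 → List Act → ℝ

/-- `p` is the Euclidean projection of `y` on `C`, that is, a point of `C` nearest to `y`. -/
def IsProjection {E : Type*} [NormedAddCommGroup E] (C : Set E) (y p : E) : Prop :=
  p ∈ C ∧ ∀ x ∈ C, ‖p - y‖ ≤ ‖x - y‖

/-- Generalized infinitesimal gradient ascent (online projected gradient descent) on the decision
set `F`, with step sizes `η`, facing the cost functions `c 1, c 2, …`: the decisions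
`x 1, x 2, …` satisfy `x (t + 1) = Π_F (x t - η t • ∇ (c t) (x t))`. -/
def IsGIGA {E : Type*} [NormedAddCommGroup E] [InnerProductSpace ℝ E] [CompleteSpace E]
    (η : ℕ → ℝ) (F : Set E) (c : ℕ → E → ℝ) (x : ℕ → E) : Prop :=
  x 1 ∈ F ∧ ∀ t, 1 ≤ t → IsProjection F (x t - η t • gradient (c t) (x t)) (x (t + 1))

namespace ExtensiveGame

variable {Act Info : Type*} [Fintype Act] [DecidableEq Act] [Fintype Info] [DecidableEq Info]

/-- The terminal histories. -/
def terminals (G : ExtensiveGame Act Info) : Finset (List Act) :=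
  G.hist.filter fun z => ∀ a, a :: z ∉ G.hist

/-- The set of histories that make up the information state `s`. -/
def infoSet (G : ExtensiveGame Act Info) (s : Info) : Finset (List Act) :=
  G.hist.filter fun h => (∃ a, a :: h ∈ G.hist) ∧ G.infoAt h = some s

/-- The utilities of the two players sum to zero. -/
def ZeroSum (G : ExtensiveGame Act Info) : Prop :=
  ∀ z ∈ G.terminals, G.utility 0 z + G.utility 1 z = 0

/-- What player `i` has experienced along a history: its own past information states, each with
the action that it chose there. -/
def experience (G : ExtensiveGame Act Info) (i : Fin 2) : List Act → List (Info × Act)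
  | [] => []
  | a :: h =>
    match G.infoAt h with
    | none => G.experience i h
    | some s => if G.player s = i then (s, a) :: G.experience i h else G.experience i h

/-- Perfect recall of both players. -/
def PerfectRecall (G : ExtensiveGame Act Info) : Prop :=
  ∀ s, ∀ h ∈ G.infoSet s, ∀ h' ∈ G.infoSet s,
    G.experience (G.player s) h = G.experience (G.player s) h'

/-- The probability simplex `Δ_s` over the actions available at `s`, in `ℝ^Act`. -/
def simplex (G : ExtensiveGame Act Info) (s : Info) : Set (EuclideanSpace ℝ Act) :=
  {x | (∀ a, 0 ≤ x a) ∧ (∀ a, a ∉ G.avail s → x a = 0) ∧ ∑ a, x a = 1}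

/-- A table `θ_{s,a}` is a joint policy if each of its rows is a distribution over the available
actions. The policy of player `i` consists of the rows `s` with `G.player s = i`. -/
def IsPolicy (G : ExtensiveGame Act Info) (π : Info → EuclideanSpace ℝ Act) : Prop :=
  ∀ s, π s ∈ G.simplex s

/-- The joint policy `(x_i, y_{-i})`: player `i` uses its part of `x`, the other player its part
of `y`. -/
def combine (G : ExtensiveGame Act Info) (i : Fin 2) (x y : Info → EuclideanSpace ℝ Act) :
    Info → EuclideanSpace ℝ Act :=
  fun s => if G.player s = i then x s else y s

/-- The probability that `a` is played at `h`. -/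
def actProb (G : ExtensiveGame Act Info) (π : Info → EuclideanSpace ℝ Act) (h : List Act)
    (a : Act) : ℝ :=
  match G.infoAt h with
  | none => G.chance h a
  | some s => π s a

/-- `η_π(h)`: the probability of reaching `h`. -/
def reach (G : ExtensiveGame Act Info) (π : Info → EuclideanSpace ℝ Act) : List Act → ℝ
  | [] => 1
  | a :: h => G.reach π h * G.actProb π h a

/-- `η_π(h, z)`: the probability of reaching `z` from `h` (zero if `h` is not a prefix of `z`). -/
def reachFrom (G : ExtensiveGame Act Info) (π : Info → EuclideanSpace ℝ Act) (h : List Act) :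
    List Act → ℝ
  | [] => if h = [] then 1 else 0
  | a :: z => if h = a :: z then 1 else G.reachFrom π h z * G.actProb π z a

/-- `η_{-i,π}(h)`: the contribution of everyone but player `i` (the opponent and chance) to the
probability of reaching `h`. -/
def oppReach (G : ExtensiveGame Act Info) (i : Fin 2) (π : Info → EuclideanSpace ℝ Act) :
    List Act → ℝ
  | [] => 1
  | a :: h => G.oppReach i π h *
      (if (G.infoAt h).map G.player = some i then 1 else G.actProb π h a)

/-- `v_{i,π}`: the expected utility of player `i`. -/
def value (G : ExtensiveGame Act Info) (i : Fin 2) (π : Info → EuclideanSpace ℝ Act) : ℝ :=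
  ∑ z ∈ G.terminals, G.reach π z * G.utility i z

/-- `q_{i,π}(h, a)`: the expected utility of player `i` when `π` is played from the history `h`
followed by `a`. -/
def histValue (G : ExtensiveGame Act Info) (i : Fin 2) (π : Info → EuclideanSpace ℝ Act)
    (h : List Act) (a : Act) : ℝ :=
  ∑ z ∈ G.terminals with (a :: h) <:+ z, G.reachFrom π (a :: h) z * G.utility i z

/-- The vector `q^c_{i,π}(s) ∈ ℝ^Act` of counterfactual values
`q^c_{i,π}(s, a) = ∑ h ∈ s, η_{-i,π}(h) q_{i,π}(h, a)`. -/
noncomputable def cfValues (G : ExtensiveGame Act Info) (i : Fin 2)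
    (π : Info → EuclideanSpace ℝ Act) (s : Info) : EuclideanSpace ℝ Act :=
  WithLp.toLp 2 fun a => ∑ h ∈ G.infoSet s, G.oppReach i π h * G.histValue i π h a

/-- The part of player `i` in the joint policy `b` is a best response to `π_{-i}`. -/
def IsBestResponse (G : ExtensiveGame Act Info) (i : Fin 2)
    (π b : Info → EuclideanSpace ℝ Act) : Prop :=
  G.IsPolicy b ∧
    ∀ x, G.IsPolicy x → G.value i (G.combine i x π) ≤ G.value i (G.combine i b π)

/-- `δ_i(π)`: how much player `i` can gain by switching to a best response. -/
noncomputable def exploitability (G : ExtensiveGame Act Info) (i : Fin 2)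
    (π : Info → EuclideanSpace ℝ Act) : ℝ :=
  sSup ((fun x => G.value i (G.combine i x π)) '' {x | G.IsPolicy x}) - G.value i π

/-- `π` is an `ε`-Nash equilibrium. -/
def IsApproxNash (G : ExtensiveGame Act Info) (ε : ℝ) (π : Info → EuclideanSpace ℝ Act) : Prop :=
  G.IsPolicy π ∧ ∀ i, G.exploitability i π ≤ ε

/-- The policy of player `i` in `π` is player `i`'s part of some `ε`-Nash equilibrium. -/
def IsPartOfApproxNash (G : ExtensiveGame Act Info) (ε : ℝ) (i : Fin 2)
    (π : Info → EuclideanSpace ℝ Act) : Prop :=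
  ∃ σ, G.IsApproxNash ε σ ∧ ∀ s, G.player s = i → σ s = π s

/-- A run of TabularED(`q^c`, `ℓ₂`) by both players with learning rates `α 1, α 2, …`. The joint
policies are `π 0, π 1, …`; in iteration `t + 1` each player `i` computes a best response
`b_i^{t+1}` to `π^t_{-i}`, and then the row of every information state `s` of every player `i` moves
by `α^{t+1}` along the counterfactual values of `(π_i^t, b_{-i}^{t+1})` and is projected
back on `Δ_s`. -/
structure IsTabularED (G : ExtensiveGame Act Info) (α : ℕ → ℝ)
    (π b : ℕ → Info → EuclideanSpace ℝ Act) : Prop where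
  init : G.IsPolicy (π 0)
  best_response : ∀ t i, G.IsBestResponse i (π t) (b (t + 1))
  update : ∀ t s, IsProjection (G.simplex s)
    (π t s + α (t + 1) •
      G.cfValues (G.player s) (G.combine (G.player s) (π t) (b (t + 1))) s)
    (π (t + 1) s)

/-- A run of CFR-BR by both players. `Local F c x` says that the local learner produces the
decisions `x 1, x 2, …` from the decision set `F` when it faces the cost functions `c 1, c 2, …`.
In iteration `t ≥ 1` each player `i` computes a best response `b_i^t` to `σ^t_{-i}`; an
independent copy of the local learner at each information state `s` of each player `i` chooses
`σ^t(s)` and then faces as cost the negated linear payoff `x ↦ ∑ a, x_a q^c(s, a)`, where `q^c` are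
the counterfactual values of `(σ_i^t, b_{-i}^t)`. -/
structure IsCFRBR (G : ExtensiveGame Act Info)
    (Local : Set (EuclideanSpace ℝ Act) → (ℕ → EuclideanSpace ℝ Act → ℝ) →
      (ℕ → EuclideanSpace ℝ Act) → Prop)
    (σ b : ℕ → Info → EuclideanSpace ℝ Act) : Prop where
  best_response : ∀ t, 1 ≤ t → ∀ i, G.IsBestResponse i (σ t) (b t)
  local_learner : ∀ s, Local (G.simplex s)
    (fun t x => -∑ a, x a *
      G.cfValues (G.player s) (G.combine (G.player s) (σ t) (b t)) s a)
    (fun t => σ t s)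

/-- `π t` is a best iterate of player `i` among `π 1, …, π T`: it has the highest expected
value against the opponent's best response. -/
def IsBestIterate (G : ExtensiveGame Act Info) (i : Fin 2)
    (π b : ℕ → Info → EuclideanSpace ℝ Act) (T t : ℕ) : Prop :=
  t ∈ Finset.Icc 1 T ∧ ∀ k ∈ Finset.Icc 1 T,
    G.value i (G.combine i (π k) (b (k + 1))) ≤ G.value i (G.combine i (π t) (b (t + 1)))

/-- `|S_i|`: the number of information states of player `i`. -/
def numInfo (G : ExtensiveGame Act Info) (i : Fin 2) : ℕ :=
  (Finset.univ.filter fun s => G.player s = i).card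

/-- `|A_i|`: the largest number of actions available at an information state of player `i`. -/
def numActions (G : ExtensiveGame Act Info) (i : Fin 2) : ℕ :=
  (Finset.univ.filter fun s => G.player s = i).sup fun s => (G.avail s).card

/-- `Δ_{u_i}`: the largest difference of two utilities of player `i` (a maximum over a finite,
nonempty set). -/
noncomputable def utilityRange (G : ExtensiveGame Act Info) (i : Fin 2) : ℝ :=
  ⨆ p : G.terminals × G.terminals, (G.utility i p.1 - G.utility i p.2)

/-- `ε = |S_i| (√T + (√T - 1/2) |A_i| Δ_{u_i}²)`. -/
noncomputable def regretBound (G : ExtensiveGame Act Info) (i : Fin 2) (T : ℕ) : ℝ :=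
  (G.numInfo i : ℝ) *
    (Real.sqrt T + (Real.sqrt T - 1 / 2) * (G.numActions i : ℝ) * G.utilityRange i ^ 2)

end ExtensiveGame

/-!
The equivalence of the two algorithms is a shift of the index by one, because the gradient of the
cost `x ↦ -∑ a, x a * q a` is `-q`.

For the convergence, fix a player `i` and let `w t` be the value that the iterate `π t` guarantees
player `i`, which is its value against the best response `b (t + 1)`. Under perfect recall the
regret of player `i` for not having played `x` against these best responses splits over the
information states (`value_combine_sub_value_combine`): each one contributes the regret of its copy
of projected gradient ascent, weighted by a reach probability in `[0, 1]`. The local regrets are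
bounded by the usual potential argument (`sum_inner_le_of_isProjection`). It needs a bound on the
counterfactual values, which lie in an interval of length `Δ` after subtraction of a constant, since
the reach weights of an information state add up to at most `1`
(`IsPolicy.sum_oppReach_le_one`); projection on the simplex and regret do not see the
constant. Thus `∑ t, value x (b (t + 1)) ≤ ∑ t, w t + 2 ε` over `t = 1, …, T` for all `x`
(`IsTabularED.sum_value_sub_le`).

This bound also yields the minimax theorem (`IsTabularED.exists_isSaddle`). With `V = sup w`, a limit
of iterates guarantees `V`. By Kuhn's averaging the best responses up to round `T` can be replaced by
a single policy (`exists_isPolicy_average_ownReach`), which holds player `i` down to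
`V + 2 ε / T`, and a limit of these policies holds player `i` down to `V`. Applied with an optimal
`x`, the same regret bound shows that the best of the first `T` iterates guarantees at least
`V - 2 ε / T`, so that together with an optimal policy of the opponent it is a `2 ε / T`-Nash
equilibrium. As `ε` is of order `√T`, compactness of the set of policies brings the best iterate
close to the policies that guarantee `V`.
-/

set_option linter.unusedSectionVars false

namespace ExtensiveGame

section Tree

variable {Act Info : Type*} [Fintype Act] [DecidableEq Act] [Fintype Info] [DecidableEq Info]
  (G : ExtensiveGame Act Info)

/-! ### The tree of histories -/

theorem mem_hist_of_suffix {h z : List Act} (hz : z ∈ G.hist) (hs : h <:+ z) : h ∈ G.hist := by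
  induction z with
  | nil => rwa [List.suffix_nil.1 hs]
  | cons a z ih =>
    rcases List.suffix_cons_iff.1 hs with rfl | hs
    · exact hz
    · exact ih (G.prefix_mem a z hz) hs

/-- Backward induction: a property that passes from the successors of a history to the history
holds at all histories. -/
theorem hist_induction {P : List Act → Prop}
    (step : ∀ h ∈ G.hist, (∀ a, a :: h ∈ G.hist → P (a :: h)) → P h) :
    ∀ h ∈ G.hist, P h := by
  have key : ∀ n, ∀ h ∈ G.hist, G.hist.sup List.length ≤ h.length + n → P h := by
    intro n
    induction n with
    | zero =>
      intro h hh hn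
      refine step h hh fun a ha => ?_
      have := Finset.le_sup (f := List.length) ha
      simp only [List.length_cons] at this
      omega
    | succ n ih =>
      intro h hh hn
      refine step h hh fun a ha => ih _ ha ?_
      simp only [List.length_cons]
      omega
  exact fun h hh => key _ h hh (Nat.le_add_left _ _)

theorem suffix_eq_or_cons {h z : List Act} (hs : h <:+ z) : z = h ∨ ∃ a, a :: h <:+ z := by
  induction z with
  | nil => exact Or.inl (List.suffix_nil.1 hs).symm
  | cons b z ih =>
    rcases List.suffix_cons_iff.1 hs with rfl | hs
    · exact Or.inl rfl
    · rcases ih hs with rfl | ⟨a, ha⟩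
      · exact Or.inr ⟨b, List.suffix_rfl⟩
      · exact Or.inr ⟨a, ha.trans (List.suffix_cons b z)⟩

theorem eq_of_cons_suffix {a b : Act} {h z : List Act} (ha : a :: h <:+ z) (hb : b :: h <:+ z) :
    a = b := by
  have := (List.suffix_of_suffix_length_le ha hb (by simp)).eq_of_length (by simp)
  exact (List.cons.inj this).1

/-- The elements of a set of histories that properly extend `h` are sorted by the action taken
at `h`. -/
theorem sum_suffix_eq {S : Finset (List Act)} (hS : S ⊆ G.hist) {h : List Act} (hh : h ∉ S)
    (f : List Act → ℝ) :
    ∑ z ∈ S with h <:+ z, f z = ∑ a with a :: h ∈ G.hist, ∑ z ∈ S with (a :: h) <:+ z, f z := by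
  rw [← Finset.sum_biUnion]
  · refine Finset.sum_congr ?_ fun _ _ => rfl
    ext z
    simp only [Finset.mem_filter, Finset.mem_biUnion, Finset.mem_univ, true_and]
    constructor
    · rintro ⟨hz, hs⟩
      rcases suffix_eq_or_cons hs with rfl | ⟨a, ha⟩
      · exact absurd hz hh
      · exact ⟨a, G.mem_hist_of_suffix (hS hz) ha, hz, ha⟩
    · rintro ⟨a, -, hz, ha⟩
      exact ⟨hz, (List.suffix_cons a h).trans ha⟩
  · intro a _ b _ hab
    simp only [Function.onFun]
    rw [Finset.disjoint_left]
    intro z hz hz'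
    exact hab (eq_of_cons_suffix (Finset.mem_filter.1 hz).2 (Finset.mem_filter.1 hz').2)

/-- Every history other than the root is a nonterminal history followed by an action. -/
theorem sum_hist_eq (f : List Act → ℝ) :
    ∑ h ∈ G.hist, f h = f [] +
      ∑ h ∈ G.hist with (∃ a, a :: h ∈ G.hist), ∑ a with a :: h ∈ G.hist, f (a :: h) := by
  rw [← Finset.add_sum_erase _ _ G.root_mem, Finset.sum_sigma']
  congr 1
  symm
  refine Finset.sum_bij (fun p _ => p.2 :: p.1) ?_ ?_ ?_ fun _ _ => rfl
  · rintro ⟨h, a⟩ hp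
    simp only [Finset.mem_sigma, Finset.mem_filter, Finset.mem_univ, true_and] at hp
    exact Finset.mem_erase.2 ⟨by simp, hp.2⟩
  · rintro ⟨h, a⟩ _ ⟨h', a'⟩ _ he
    obtain ⟨rfl, rfl⟩ := List.cons.inj he
    rfl
  · intro z hz
    obtain ⟨hz0, hz⟩ := Finset.mem_erase.1 hz
    cases z with
    | nil => exact absurd rfl hz0
    | cons a h =>
      refine ⟨⟨h, a⟩, ?_, rfl⟩
      simp only [Finset.mem_sigma, Finset.mem_filter, Finset.mem_univ, true_and]
      exact ⟨⟨G.prefix_mem a h hz, a, hz⟩, hz⟩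

theorem terminals_nonempty : G.terminals.Nonempty := by
  obtain ⟨z, hz, hmax⟩ := G.hist.exists_max_image List.length ⟨[], G.root_mem⟩
  refine ⟨z, Finset.mem_filter.2 ⟨hz, fun a ha => ?_⟩⟩
  have := hmax _ ha
  simp at this

theorem mem_terminals {z : List Act} :
    z ∈ G.terminals ↔ z ∈ G.hist ∧ ∀ a, a :: z ∉ G.hist := by
  simp [terminals]

theorem mem_infoSet {s : Info} {h : List Act} :
    h ∈ G.infoSet s ↔ h ∈ G.hist ∧ (∃ a, a :: h ∈ G.hist) ∧ G.infoAt h = some s := by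
  simp [infoSet]

theorem infoSet_nonempty (s : Info) : (G.infoSet s).Nonempty := by
  obtain ⟨h, hh, hn, hs⟩ := G.info_nonempty s
  exact ⟨h, G.mem_infoSet.2 ⟨hh, hn, hs⟩⟩

theorem mem_avail_of_mem_infoSet {s : Info} {h : List Act} (hh : h ∈ G.infoSet s) (a : Act) :
    a ∈ G.avail s ↔ a :: h ∈ G.hist := by
  obtain ⟨hm, hn, hs⟩ := G.mem_infoSet.1 hh
  exact G.mem_avail h hm hn s hs a

/-- The sum over the nonterminal histories at which player `i` moves is sorted by information
state. -/
theorem sum_nonterminal_eq_sum_infoSet (i : Fin 2) (f : List Act → ℝ)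
    (hf : ∀ h, (∀ s, G.infoAt h = some s → G.player s ≠ i) → f h = 0) :
    ∑ h ∈ G.hist with (∃ a, a :: h ∈ G.hist), f h =
      ∑ s with G.player s = i, ∑ h ∈ G.infoSet s, f h := by
  have h1 : ∀ s, ∑ h ∈ G.infoSet s, f h = ∑ h ∈ G.hist with (∃ a, a :: h ∈ G.hist),
      if G.infoAt h = some s then f h else 0 := by
    intro s
    rw [infoSet, ← Finset.filter_filter, Finset.sum_filter]
  simp only [h1]
  rw [Finset.sum_comm]
  refine Finset.sum_congr rfl fun h _ => ?_
  cases hs : G.infoAt h with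
  | none => simpa using hf h (by simp [hs])
  | some s =>
    simp only [Option.some.injEq]
    rw [Finset.sum_ite_eq]
    split_ifs with hi
    · rfl
    · refine hf h fun s' hs' => ?_
      rw [hs] at hs'
      obtain rfl := Option.some.inj hs'
      simpa using hi

/-! ### Policies and reach probabilities -/

theorem simplex_le_one {s : Info} {x : EuclideanSpace ℝ Act} (hx : x ∈ G.simplex s) (a : Act) :
    x a ≤ 1 := by
  rw [← hx.2.2]
  exact Finset.single_le_sum (fun b _ => hx.1 b) (Finset.mem_univ a)

variable {G}

theorem IsPolicy.combine {x y : Info → EuclideanSpace ℝ Act} (hx : G.IsPolicy x)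
    (hy : G.IsPolicy y) (i : Fin 2) : G.IsPolicy (G.combine i x y) := by
  intro s
  unfold ExtensiveGame.combine
  split_ifs
  · exact hx s
  · exact hy s

theorem IsPolicy.actProb_nonneg {π : Info → EuclideanSpace ℝ Act} (hπ : G.IsPolicy π)
    {h : List Act} {a : Act} (ha : a :: h ∈ G.hist) : 0 ≤ G.actProb π h a := by
  unfold actProb
  cases hs : G.infoAt h with
  | none => exact G.chance_nonneg h (G.prefix_mem a h ha) hs a ha
  | some s => exact (hπ s).1 a

theorem IsPolicy.sum_actProb {π : Info → EuclideanSpace ℝ Act} (hπ : G.IsPolicy π)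
    {h : List Act} (hh : h ∈ G.hist) (hn : ∃ a, a :: h ∈ G.hist) :
    ∑ a with a :: h ∈ G.hist, G.actProb π h a = 1 := by
  unfold actProb
  cases hs : G.infoAt h with
  | none => exact G.chance_sum h hh hn hs
  | some s =>
    simp only
    rw [← (hπ s).2.2]
    refine Finset.sum_subset (Finset.subset_univ _) fun a _ ha => (hπ s).2.1 a ?_
    rw [G.mem_avail h hh hn s hs a]
    simpa using ha

theorem IsPolicy.oppReach_nonneg {π : Info → EuclideanSpace ℝ Act} (hπ : G.IsPolicy π)
    (i : Fin 2) {h : List Act} (hh : h ∈ G.hist) : 0 ≤ G.oppReach i π h := by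
  induction h with
  | nil => simp [oppReach]
  | cons a h ih =>
    refine mul_nonneg (ih (G.prefix_mem a h hh)) ?_
    split_ifs
    · exact zero_le_one
    · exact hπ.actProb_nonneg hh

variable (G)

/-- The contribution of player `i`, using its part of `x`, to the probability of reaching `h`. It
depends only on the experience of player `i`. -/
def ownReach (i : Fin 2) (x : Info → EuclideanSpace ℝ Act) (h : List Act) : ℝ :=
  ((G.experience i h).map fun p => x p.1 p.2).prod

/-- The contribution of chance to the probability of reaching `h`. -/
def chanceReach (G : ExtensiveGame Act Info) : List Act → ℝ
  | [] => 1
  | a :: h => G.chanceReach h * (match G.infoAt h with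
    | none => G.chance h a
    | some _ => 1)

theorem experience_cons_none {i : Fin 2} {h : List Act} (hs : G.infoAt h = none) (a : Act) :
    G.experience i (a :: h) = G.experience i h := by
  simp [experience, hs]

theorem experience_cons_self {h : List Act} {s : Info} (hs : G.infoAt h = some s)
    (a : Act) : G.experience (G.player s) (a :: h) = (s, a) :: G.experience (G.player s) h := by
  simp [experience, hs]

theorem experience_cons_ne {i : Fin 2} {h : List Act} {s : Info} (hs : G.infoAt h = some s)
    (hi : G.player s ≠ i) (a : Act) : G.experience i (a :: h) = G.experience i h := by
  simp [experience, hs, hi]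

theorem experience_suffix_cons (i : Fin 2) (a : Act) (h : List Act) :
    G.experience i h <:+ G.experience i (a :: h) := by
  cases hs : G.infoAt h with
  | none => rw [G.experience_cons_none hs]
  | some s =>
    by_cases hi : G.player s = i
    · subst hi
      rw [G.experience_cons_self hs]
      exact List.suffix_cons _ _
    · rw [G.experience_cons_ne hs hi]

theorem experience_suffix (i : Fin 2) {h z : List Act} (hz : h <:+ z) :
    G.experience i h <:+ G.experience i z := by
  induction z with
  | nil => rw [List.suffix_nil.1 hz]
  | cons a z ih =>
    rcases List.suffix_cons_iff.1 hz with rfl | hz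
    · exact List.suffix_rfl
    · exact (ih hz).trans (G.experience_suffix_cons i a z)

variable {G} in
theorem IsPolicy.ownReach_nonneg {x : Info → EuclideanSpace ℝ Act} (hx : G.IsPolicy x)
    (i : Fin 2) (h : List Act) : 0 ≤ G.ownReach i x h := by
  refine List.prod_nonneg fun r hr => ?_
  obtain ⟨p, -, rfl⟩ := List.mem_map.1 hr
  exact (hx p.1).1 p.2

variable {G} in
theorem IsPolicy.ownReach_le_one {x : Info → EuclideanSpace ℝ Act} (hx : G.IsPolicy x)
    (i : Fin 2) (h : List Act) : G.ownReach i x h ≤ 1 := by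
  unfold ownReach
  induction G.experience i h with
  | nil => simp
  | cons p l ih =>
    rw [List.map_cons, List.prod_cons]
    refine mul_le_one₀ (G.simplex_le_one (hx p.1) p.2) (List.prod_nonneg fun r hr => ?_) ih
    obtain ⟨p, -, rfl⟩ := List.mem_map.1 hr
    exact (hx p.1).1 p.2

theorem reach_combine (i : Fin 2) (x y : Info → EuclideanSpace ℝ Act) (h : List Act) :
    G.reach (G.combine i x y) h = G.ownReach i x h * G.oppReach i y h := by
  induction h with
  | nil => simp [reach, ownReach, oppReach, experience]
  | cons a h ih =>
    simp only [reach, oppReach, ih, actProb]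
    cases hs : G.infoAt h with
    | none =>
      simp only [ownReach, G.experience_cons_none hs, Option.map_none, reduceCtorEq, if_false]
      ring
    | some s =>
      by_cases hi : G.player s = i
      · subst hi
        simp only [ownReach, G.experience_cons_self hs, Option.map_some, if_true, combine,
          List.map_cons, List.prod_cons]
        ring
      · simp only [ownReach, G.experience_cons_ne hs hi, Option.map_some, Option.some.injEq, hi,
          if_false, combine]
        ring

theorem oppReach_combine (i : Fin 2) (x y : Info → EuclideanSpace ℝ Act) (h : List Act) :
    G.oppReach i (G.combine i x y) h = G.oppReach i y h := by
  induction h with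
  | nil => rfl
  | cons a h ih =>
    simp only [oppReach, ih, actProb, combine]
    cases hs : G.infoAt h with
    | none => simp
    | some s => by_cases hi : G.player s = i <;> simp [hi]

theorem ne_iff_eq_one_sub (i j : Fin 2) : j ≠ i ↔ j = 1 - i := by
  revert i j; decide

theorem oppReach_eq (i : Fin 2) (y : Info → EuclideanSpace ℝ Act) (h : List Act) :
    G.oppReach i y h = G.ownReach (1 - i) y h * G.chanceReach h := by
  induction h with
  | nil => simp [chanceReach, ownReach, oppReach, experience]
  | cons a h ih =>
    simp only [chanceReach, oppReach, ih, actProb]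
    cases hs : G.infoAt h with
    | none =>
      simp only [ownReach, G.experience_cons_none hs, Option.map_none, reduceCtorEq, if_false]
      ring
    | some s =>
      by_cases hi : G.player s = i
      · have hi' : G.player s ≠ 1 - i := by
          rw [hi]; clear ih hi; revert i; decide
        simp only [ownReach, G.experience_cons_ne hs hi', Option.map_some, if_true, hi]
        ring
      · have hi' := (ne_iff_eq_one_sub _ _).1 hi
        simp only [Option.map_some, Option.some.injEq, hi, if_false]
        rw [ownReach, ownReach, ← hi', G.experience_cons_self hs]
        simp only [List.map_cons, List.prod_cons]
        ring

/-! ### Values of subgames -/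

/-- The expected utility of player `i` when `π` is played from the history `h`. -/
def subgameValue (i : Fin 2) (π : Info → EuclideanSpace ℝ Act) (h : List Act) : ℝ :=
  ∑ z ∈ G.terminals with h <:+ z, G.reachFrom π h z * G.utility i z

theorem reachFrom_self (π : Info → EuclideanSpace ℝ Act) (h : List Act) :
    G.reachFrom π h h = 1 := by
  cases h <;> simp [reachFrom]

theorem reachFrom_nil (π : Info → EuclideanSpace ℝ Act) (z : List Act) :
    G.reachFrom π [] z = G.reach π z := by
  induction z with
  | nil => simp [reachFrom, reach]
  | cons a z ih => simp [reachFrom, reach, ih]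

theorem reachFrom_eq_of_cons_suffix (π : Info → EuclideanSpace ℝ Act) {a : Act} {h z : List Act}
    (hz : a :: h <:+ z) : G.reachFrom π h z = G.actProb π h a * G.reachFrom π (a :: h) z := by
  induction z with
  | nil => simp at hz
  | cons b z ih =>
    rcases List.suffix_cons_iff.1 hz with he | hz'
    · obtain ⟨rfl, rfl⟩ := List.cons.inj he
      simp [reachFrom, reachFrom_self]
    · have hl := hz'.length_le
      simp only [List.length_cons] at hl
      have h1 : h ≠ b :: z := fun h => by simp [h] at hl
      have h2 : a :: h ≠ b :: z := fun h => by
        have := congrArg List.length h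
        simp at this; omega
      simp only [reachFrom, h1, h2, if_false, ih hz']
      ring

theorem subgameValue_nil (i : Fin 2) (π : Info → EuclideanSpace ℝ Act) :
    G.subgameValue i π [] = G.value i π := by
  simp [subgameValue, value, reachFrom_nil]

theorem subgameValue_terminal (i : Fin 2) (π : Info → EuclideanSpace ℝ Act) {z : List Act}
    (hz : z ∈ G.terminals) : G.subgameValue i π z = G.utility i z := by
  have : G.terminals.filter (fun z' => z <:+ z') = {z} := by
    ext z'
    simp only [Finset.mem_filter, Finset.mem_singleton]
    constructor
    · rintro ⟨hz', hs⟩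
      rcases suffix_eq_or_cons hs with h | ⟨a, ha⟩
      · exact h
      · exact absurd (G.mem_hist_of_suffix (G.mem_terminals.1 hz').1 ha)
          ((G.mem_terminals.1 hz).2 a)
    · rintro rfl
      exact ⟨hz, List.suffix_rfl⟩
  rw [subgameValue, this, Finset.sum_singleton, reachFrom_self, one_mul]

theorem subgameValue_eq_zero (i : Fin 2) (π : Info → EuclideanSpace ℝ Act) {h : List Act}
    (hh : h ∉ G.hist) : G.subgameValue i π h = 0 := by
  rw [subgameValue, Finset.filter_eq_empty_iff.2, Finset.sum_empty]
  exact fun z hz hs => hh (G.mem_hist_of_suffix (G.mem_terminals.1 hz).1 hs)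

theorem subgameValue_eq_sum (i : Fin 2) (π : Info → EuclideanSpace ℝ Act) {h : List Act}
    (hn : ∃ a, a :: h ∈ G.hist) :
    G.subgameValue i π h =
      ∑ a with a :: h ∈ G.hist, G.actProb π h a * G.subgameValue i π (a :: h) := by
  obtain ⟨a₀, ha₀⟩ := hn
  rw [subgameValue, G.sum_suffix_eq (S := G.terminals) (Finset.filter_subset _ _)
    (fun hh => (G.mem_terminals.1 hh).2 a₀ ha₀)]
  refine Finset.sum_congr rfl fun a _ => ?_
  rw [subgameValue, Finset.mul_sum]
  refine Finset.sum_congr rfl fun z hz => ?_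
  rw [G.reachFrom_eq_of_cons_suffix π (Finset.mem_filter.1 hz).2, mul_assoc]

theorem cfValues_apply (i : Fin 2) (π : Info → EuclideanSpace ℝ Act) (s : Info) (a : Act) :
    G.cfValues i π s a = ∑ h ∈ G.infoSet s, G.oppReach i π h * G.subgameValue i π (a :: h) :=
  rfl

/-- The difference of the values of two tables is the sum, over the nonterminal histories reached
under the first, of the advantage that a single step of the first has over the second. -/
theorem value_sub_value (i : Fin 2) (π ρ : Info → EuclideanSpace ℝ Act) :
    G.value i π - G.value i ρ = ∑ h ∈ G.hist with (∃ a, a :: h ∈ G.hist),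
      G.reach π h * ∑ a with a :: h ∈ G.hist,
        (G.actProb π h a - G.actProb ρ h a) * G.subgameValue i ρ (a :: h) := by
  -- Telescoping of `reach π h * subgameValue i ρ h` between the root and the terminal histories.
  have h1 := G.sum_hist_eq fun h => G.reach π h * G.subgameValue i ρ h
  have h2 := Finset.sum_filter_add_sum_filter_not G.hist (fun h => ∃ a, a :: h ∈ G.hist)
    fun h => G.reach π h * G.subgameValue i ρ h
  have h3 : ∑ h ∈ G.hist with ¬ (∃ a, a :: h ∈ G.hist), G.reach π h * G.subgameValue i ρ h =
      G.value i π := by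
    have ht : G.hist.filter (fun h => ¬ ∃ a, a :: h ∈ G.hist) = G.terminals := by
      ext z; simp [mem_terminals]
    rw [ht, value]
    exact Finset.sum_congr rfl fun z hz => by rw [G.subgameValue_terminal i ρ hz]
  have h4 : ∑ h ∈ G.hist with (∃ a, a :: h ∈ G.hist), G.reach π h * ∑ a with a :: h ∈ G.hist,
        (G.actProb π h a - G.actProb ρ h a) * G.subgameValue i ρ (a :: h) =
      ∑ h ∈ G.hist with (∃ a, a :: h ∈ G.hist), ∑ a with a :: h ∈ G.hist,
        G.reach π (a :: h) * G.subgameValue i ρ (a :: h) -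
      ∑ h ∈ G.hist with (∃ a, a :: h ∈ G.hist), G.reach π h * G.subgameValue i ρ h := by
    rw [← Finset.sum_sub_distrib]
    refine Finset.sum_congr rfl fun h hh => ?_
    rw [G.subgameValue_eq_sum i ρ (Finset.mem_filter.1 hh).2]
    simp only [sub_mul, Finset.sum_sub_distrib, mul_sub, Finset.mul_sum, reach, mul_assoc]
  simp only [reach, subgameValue_nil, one_mul] at h1 h4
  linarith

end Tree

end ExtensiveGame

/-! ### Regret of projected gradient ascent -/

section Gradient

variable {E : Type*} [NormedAddCommGroup E] [InnerProductSpace ℝ E]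

theorem IsProjection.inner_le_zero {C : Set E} (hC : Convex ℝ C) {y p : E}
    (hp : IsProjection C y p) {u : E} (hu : u ∈ C) : inner ℝ (y - p) (u - p) ≤ 0 := by
  refine (norm_eq_iInf_iff_real_inner_le_zero hC hp.1).1 ?_ u hu
  have : Nonempty C := ⟨⟨p, hp.1⟩⟩
  refine le_antisymm (le_ciInf fun w => ?_) ?_
  · rw [norm_sub_rev, norm_sub_rev y]
    exact hp.2 w w.2
  · exact ciInf_le (f := fun w : C => ‖y - w‖) ⟨0, by rintro _ ⟨w, rfl⟩; exact norm_nonneg _⟩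
      ⟨p, hp.1⟩

/-- One step of projected gradient ascent. Only the component of the direction `q` along `C`
matters, so that `q` may be replaced in the bound by any `g` with the same component. -/
theorem IsProjection.step_le {C : Set E} (hC : Convex ℝ C) {x q g p u : E} {α : ℝ}
    (hx : x ∈ C) (hu : u ∈ C) (hp : IsProjection C (x + α • q) p)
    (hg : ∀ v ∈ C, ∀ w ∈ C, inner ℝ q (v - w) = inner ℝ g (v - w)) :
    2 * α * inner ℝ q (u - x) ≤ ‖x - u‖ ^ 2 - ‖p - u‖ ^ 2 + α ^ 2 * ‖g‖ ^ 2 := by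
  have h1 := hp.inner_le_zero hC hu
  have h2 : inner ℝ (x + α • g - p) (u - p) ≤ 0 := by
    have e1 : x + α • q - p = (x - p) + α • q := by abel
    have e2 : x + α • g - p = (x - p) + α • g := by abel
    rw [e1, inner_add_left, inner_smul_left, hg u hu p hp.1] at h1
    rw [e2, inner_add_left, inner_smul_left]
    exact h1
  rw [hg u hu x hx]
  have h3 : ‖x + α • g - u‖ ^ 2 =
      ‖x + α • g - p‖ ^ 2 - 2 * inner ℝ (x + α • g - p) (u - p) + ‖u - p‖ ^ 2 := by
    rw [← norm_sub_sq_real]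
    congr 2; abel
  have h4 : ‖x + α • g - u‖ ^ 2 =
      ‖x - u‖ ^ 2 - 2 * α * inner ℝ g (u - x) + α ^ 2 * ‖g‖ ^ 2 := by
    have e : x + α • g - u = (x - u) + α • g := by abel
    rw [e, norm_add_sq_real, norm_smul, inner_smul_right, mul_pow, Real.norm_eq_abs, sq_abs,
      real_inner_comm, ← neg_sub u x, inner_neg_right]
    ring
  rw [norm_sub_rev p u]
  nlinarith [sq_nonneg ‖x + α • g - p‖]

/-- The regret of projected gradient ascent with learning rates `t ^ (-1/2)` on a set of squared
diameter at most `2`, counted from the second decision on. -/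
theorem sum_inner_le_of_isProjection {C : Set E} (hC : Convex ℝ C)
    (hdiam : ∀ v ∈ C, ∀ w ∈ C, ‖v - w‖ ^ 2 ≤ 2) {x q : ℕ → E} {K : ℝ} (hx : ∀ t, x t ∈ C)
    (hstep : ∀ t : ℕ, IsProjection C
      (x t + ((t + 1 : ℕ) : ℝ) ^ (-(1 / 2) : ℝ) • q t) (x (t + 1)))
    (hq : ∀ t, ∃ g : E, ‖g‖ ^ 2 ≤ K ∧ ∀ v ∈ C, ∀ w ∈ C, inner ℝ (q t) (v - w) = inner ℝ g (v - w))
    {u : E} (hu : u ∈ C) (T : ℕ) :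
    ∑ t ∈ Finset.Icc 1 T, inner ℝ (q t) (u - x t) ≤
      √(T + 1) + (√(T + 1) - 1) * K := by
  have hK : 0 ≤ K := by
    obtain ⟨g, hg, -⟩ := hq 0
    exact (sq_nonneg _).trans hg
  suffices h : ∑ t ∈ Finset.Icc 1 T, inner ℝ (q t) (u - x t) ≤
      √(T + 1) - √(T + 1) / 2 * ‖x (T + 1) - u‖ ^ 2 + (√(T + 1) - 1) * K by
    have : 0 ≤ √((T : ℝ) + 1) / 2 * ‖x (T + 1) - u‖ ^ 2 := by positivity
    linarith
  induction T with
  | zero =>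
    have := hdiam _ (hx 1) _ hu
    simp
    linarith
  | succ T ih =>
    rw [Finset.sum_Icc_succ_top (by omega)]
    obtain ⟨g, hgK, hg⟩ := hq (T + 1)
    have h1 := (hstep (T + 1)).step_le hC (hx _) hu hg
    have hd := hdiam _ (hx (T + 1)) _ hu
    push_cast at h1 ⊢
    have hr0 : (0 : ℝ) < (T : ℝ) + 1 + 1 := by positivity
    rw [Real.rpow_neg hr0.le, ← Real.sqrt_eq_rpow] at h1
    set r := √((T : ℝ) + 1 + 1) with hr
    set r' := √((T : ℝ) + 1) with hr'
    have hrpos : 0 < r := Real.sqrt_pos.2 hr0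
    have hr'0 : 0 ≤ r' := Real.sqrt_nonneg _
    have hle : r' ≤ r := Real.sqrt_le_sqrt (by linarith)
    have hsq : r ^ 2 = r' ^ 2 + 1 := by
      rw [hr, hr', Real.sq_sqrt (by positivity), Real.sq_sqrt (by positivity)]
    have hinv : r⁻¹ / 2 ≤ r - r' := by
      rw [div_le_iff₀ two_pos, inv_le_iff_one_le_mul₀ hrpos]
      nlinarith
    have h2 : inner ℝ (q (T + 1)) (u - x (T + 1)) ≤
        r / 2 * (‖x (T + 1) - u‖ ^ 2 - ‖x (T + 1 + 1) - u‖ ^ 2) + r⁻¹ / 2 * K := by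
      have h3 := mul_le_mul_of_nonneg_left h1 (half_pos hrpos).le
      have e1 : r / 2 * (2 * r⁻¹ * inner ℝ (q (T + 1)) (u - x (T + 1))) =
          inner ℝ (q (T + 1)) (u - x (T + 1)) := by field_simp
      have e2 : r / 2 * (‖x (T + 1) - u‖ ^ 2 - ‖x (T + 1 + 1) - u‖ ^ 2 + r⁻¹ ^ 2 * ‖g‖ ^ 2) =
          r / 2 * (‖x (T + 1) - u‖ ^ 2 - ‖x (T + 1 + 1) - u‖ ^ 2) + r⁻¹ / 2 * ‖g‖ ^ 2 := by
        field_simp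
      rw [e1, e2] at h3
      have := mul_le_mul_of_nonneg_left hgK (half_pos (inv_pos.2 hrpos)).le
      linarith
    have h5 := mul_le_mul_of_nonneg_right hinv hK
    nlinarith [mul_nonneg (sub_nonneg.2 hle) (sub_nonneg.2 hd)]

end Gradient

namespace ExtensiveGame

section Regret

variable {Act Info : Type*} [Fintype Act] [DecidableEq Act] [Fintype Info] [DecidableEq Info]
  (G : ExtensiveGame Act Info)

/-! ### Counterfactual regret decomposition -/

/-- The contribution of the player who moves at `s` to the probability of reaching `s`, computed
at some history in `s`. Under perfect recall the choice of the history does not matter. -/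
noncomputable def infoReach (x : Info → EuclideanSpace ℝ Act) (s : Info) : ℝ :=
  G.ownReach (G.player s) x (G.infoSet_nonempty s).choose

variable {G}

theorem ownReach_eq_infoReach (hG : G.PerfectRecall) (x : Info → EuclideanSpace ℝ Act) {s : Info}
    {h : List Act} (hh : h ∈ G.infoSet s) : G.ownReach (G.player s) x h = G.infoReach x s := by
  rw [infoReach, ownReach, ownReach, hG s h hh _ (G.infoSet_nonempty s).choose_spec]

/-- The change of value when player `i` switches from `y` to `x` is a combination of the changes of
the linear payoffs that the counterfactual values of `y` define at the information states of
player `i`. -/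
theorem value_combine_sub_value_combine (hG : G.PerfectRecall) (i : Fin 2)
    (x y b : Info → EuclideanSpace ℝ Act) :
    G.value i (G.combine i x b) - G.value i (G.combine i y b) =
      ∑ s with G.player s = i, G.infoReach x s *
        inner ℝ (G.cfValues i (G.combine i y b) s) (x s - y s) := by
  rw [value_sub_value, G.sum_nonterminal_eq_sum_infoSet i]
  · refine Finset.sum_congr rfl fun s hs => ?_
    obtain rfl : G.player s = i := by simpa using hs
    have h1 : ∀ h ∈ G.infoSet s, G.reach (G.combine (G.player s) x b) h *
        ∑ a with a :: h ∈ G.hist, (G.actProb (G.combine (G.player s) x b) h a -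
          G.actProb (G.combine (G.player s) y b) h a) *
            G.subgameValue (G.player s) (G.combine (G.player s) y b) (a :: h) =
        G.infoReach x s * ∑ a, (x s a - y s a) * (G.oppReach (G.player s)
          (G.combine (G.player s) y b) h *
            G.subgameValue (G.player s) (G.combine (G.player s) y b) (a :: h)) := by
      intro h hh
      obtain ⟨-, -, hs⟩ := G.mem_infoSet.1 hh
      rw [reach_combine, ownReach_eq_infoReach hG x hh, oppReach_combine, mul_assoc]
      congr 1
      rw [Finset.sum_filter, Finset.mul_sum]
      refine Finset.sum_congr rfl fun a _ => ?_
      split_ifs with ha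
      · simp only [actProb, hs, combine, if_true]
        ring
      · rw [G.subgameValue_eq_zero _ _ ha]
        ring
    rw [Finset.sum_congr rfl h1, ← Finset.mul_sum, Finset.sum_comm]
    congr 1
    simp only [PiLp.inner_apply, RCLike.inner_apply, conj_trivial, cfValues_apply, PiLp.sub_apply,
      Finset.mul_sum]
  · intro h hh
    refine mul_eq_zero_of_right _ (Finset.sum_eq_zero fun a _ => ?_)
    refine mul_eq_zero_of_left (sub_eq_zero.2 ?_) _
    unfold actProb
    cases hs : G.infoAt h with
    | none => rfl
    | some s => simp [combine, hh s hs]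

/-! ### Bounds on counterfactual values -/

/-- The total of a superharmonic function over an antichain is at most its value at the root. -/
theorem sum_antichain_le {S : Finset (List Act)} (hS : S ⊆ G.hist)
    (hanti : ∀ h ∈ S, ∀ g ∈ S, h <:+ g → g = h) {M : List Act → ℝ}
    (hM0 : ∀ h ∈ G.hist, 0 ≤ M h)
    (hM : ∀ h ∈ G.hist, (∃ a, a :: h ∈ G.hist) → ∑ a with a :: h ∈ G.hist, M (a :: h) ≤ M h) :
    ∑ g ∈ S, M g ≤ M [] := by
  have key : ∀ h ∈ G.hist, ∑ g ∈ S with h <:+ g, M g ≤ M h := by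
    refine G.hist_induction fun h hh ih => ?_
    by_cases hs : h ∈ S
    · have : S.filter (fun g => h <:+ g) = {h} := by
        ext g
        simp only [Finset.mem_filter, Finset.mem_singleton]
        exact ⟨fun hg => hanti h hs g hg.1 hg.2, by rintro rfl; exact ⟨hs, List.suffix_rfl⟩⟩
      rw [this, Finset.sum_singleton]
    · rw [G.sum_suffix_eq hS hs]
      by_cases hn : ∃ a, a :: h ∈ G.hist
      · refine le_trans (Finset.sum_le_sum fun a ha => ih a ?_) (hM h hh hn)
        simpa using ha
      · push Not at hn
        rw [Finset.sum_eq_zero fun a ha => absurd (Finset.mem_filter.1 ha).2 (hn a)]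
        exact hM0 h hh
  simpa using key [] G.root_mem

/-- Under perfect recall a history of an information state does not pass through the same
information state earlier. -/
theorem infoSet_antichain (hG : G.PerfectRecall) {s : Info} {h g : List Act}
    (hh : h ∈ G.infoSet s) (hg : g ∈ G.infoSet s) (hs : h <:+ g) : g = h := by
  rcases suffix_eq_or_cons hs with he | ⟨a, ha⟩
  · exact he
  · have h1 := (G.experience_suffix (G.player s) ha).length_le
    rw [G.experience_cons_self (G.mem_infoSet.1 hh).2.2, hG s h hh g hg] at h1
    simp at h1

/-- Chance and the opponent reach an information state with total weight at most `1`: this is the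
probability of reaching it when its player steers towards it. -/
theorem IsPolicy.sum_oppReach_le_one (hG : G.PerfectRecall) {π : Info → EuclideanSpace ℝ Act}
    (hπ : G.IsPolicy π) (s : Info) : ∑ h ∈ G.infoSet s, G.oppReach (G.player s) π h ≤ 1 := by
  classical
  set i := G.player s with hi
  obtain ⟨h₀, hh₀⟩ := G.infoSet_nonempty s
  set e := G.experience i h₀ with he
  -- The reach probability when player `i` plays so as to have the experience `e`.
  let M : List Act → ℝ := fun h => if G.experience i h <:+ e then G.oppReach i π h else 0
  have hM0 : ∀ h ∈ G.hist, 0 ≤ M h := by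
    intro h hh
    simp only [M]
    split_ifs
    · exact hπ.oppReach_nonneg i hh
    · exact le_rfl
  have h1 : ∀ h ∈ G.infoSet s, G.oppReach i π h = M h := by
    intro h hh
    simp only [M, he, hG s h hh h₀ hh₀, hi, List.suffix_rfl, if_true]
  rw [Finset.sum_congr rfl h1]
  refine (sum_antichain_le (G := G) (Finset.filter_subset _ _)
    (fun h hh g hg => infoSet_antichain hG hh hg) hM0 ?_).trans (by simp [M, experience, oppReach])
  intro h hh hn
  by_cases hsuf : G.experience i h <:+ e
  · have hMh : M h = G.oppReach i π h := by simp [M, hsuf]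
    by_cases ho : (G.infoAt h).map G.player = some i
    · obtain ⟨s', hs', hp⟩ := Option.map_eq_some_iff.1 ho
      have hM' : ∀ a, M (a :: h) =
          if (s', a) :: G.experience i h <:+ e then G.oppReach i π h else 0 := by
        intro a
        simp only [M, oppReach, ho, if_true, mul_one]
        rw [← hp, G.experience_cons_self hs']
      have h0 := hπ.oppReach_nonneg i hh
      simp only [hM', hMh]
      by_cases hex : ∃ a, (s', a) :: G.experience i h <:+ e
      · obtain ⟨a₀, ha₀⟩ := hex
        calc _ ≤ ∑ a, if a = a₀ then G.oppReach i π h else 0 := by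
              refine (Finset.sum_le_sum_of_subset_of_nonneg (Finset.subset_univ _)
                fun a _ _ => by split_ifs <;> simp [h0]).trans
                (Finset.sum_le_sum fun a _ => ?_)
              split_ifs with ha hb hb
              · exact le_rfl
              · exact absurd (Prod.mk.inj (eq_of_cons_suffix ha ha₀)).2 hb
              · exact h0
              · exact le_rfl
          _ = _ := by simp
      · push Not at hex
        simp [hex, h0]
    · have hM' : ∀ a, M (a :: h) = G.oppReach i π h * G.actProb π h a := by
        intro a
        have : G.experience i (a :: h) = G.experience i h := by
          cases hs' : G.infoAt h with
          | none => exact G.experience_cons_none hs' a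
          | some s' => exact G.experience_cons_ne hs' (fun hp => ho (by simp [hs', hp])) a
        simp only [M, this, hsuf, if_true, oppReach, ho, if_false]
      simp only [hM', hMh]
      rw [← Finset.mul_sum, hπ.sum_actProb hh hn, mul_one]
  · have : ∀ a, M (a :: h) = 0 := fun a => by
      simp only [M, ite_eq_right_iff]
      exact fun ha => absurd ((G.experience_suffix_cons i a h).trans ha) hsuf
    simp [this, hM0 h hh]

theorem IsPolicy.subgameValue_mem_Icc {π : Info → EuclideanSpace ℝ Act} (hπ : G.IsPolicy π)
    {i : Fin 2} {m M : ℝ} (hu : ∀ z ∈ G.terminals, G.utility i z ∈ Set.Icc m M) :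
    ∀ h ∈ G.hist, G.subgameValue i π h ∈ Set.Icc m M := by
  refine G.hist_induction fun h hh ih => ?_
  by_cases hn : ∃ a, a :: h ∈ G.hist
  · rw [G.subgameValue_eq_sum i π hn]
    refine (convex_Icc m M).sum_mem (fun a ha => ?_) (hπ.sum_actProb hh hn) fun a ha => ?_
    · exact hπ.actProb_nonneg (Finset.mem_filter.1 ha).2
    · exact ih a (Finset.mem_filter.1 ha).2
  · push Not at hn
    have hz := G.mem_terminals.2 ⟨hh, hn⟩
    rw [G.subgameValue_terminal i π hz]
    exact hu h hz

theorem sub_le_utilityRange (i : Fin 2) {z z' : List Act} (hz : z ∈ G.terminals)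
    (hz' : z' ∈ G.terminals) : G.utility i z - G.utility i z' ≤ G.utilityRange i :=
  le_ciSup (f := fun p : G.terminals × G.terminals => G.utility i p.1 - G.utility i p.2)
    (Set.finite_range _).bddAbove (⟨z, hz⟩, ⟨z', hz'⟩)

/-- Up to a common constant, the counterfactual values of the available actions lie between `0`
and the range of the utilities. The utilities themselves may be far from `0`. -/
theorem IsPolicy.exists_cfValues_sub_mem_Icc (hG : G.PerfectRecall)
    {π : Info → EuclideanSpace ℝ Act} (hπ : G.IsPolicy π) (s : Info) :
    ∃ c, ∀ a ∈ G.avail s,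
      G.cfValues (G.player s) π s a - c ∈ Set.Icc 0 (G.utilityRange (G.player s)) := by
  set i := G.player s with hi
  obtain ⟨z₀, hz₀, hmin⟩ := G.terminals.exists_min_image (G.utility i) G.terminals_nonempty
  have hu : ∀ z ∈ G.terminals, G.utility i z ∈
      Set.Icc (G.utility i z₀) (G.utility i z₀ + G.utilityRange i) := fun z hz =>
    ⟨hmin z hz, by linarith [sub_le_utilityRange i hz hz₀]⟩
  have hr : 0 ≤ G.utilityRange i := by simpa using sub_le_utilityRange i hz₀ hz₀
  refine ⟨(∑ h ∈ G.infoSet s, G.oppReach i π h) * G.utility i z₀, fun a ha => ?_⟩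
  rw [cfValues_apply, Finset.sum_mul, ← Finset.sum_sub_distrib]
  have hV : ∀ h ∈ G.infoSet s, 0 ≤ G.oppReach i π h ∧ G.subgameValue i π (a :: h) ∈
      Set.Icc (G.utility i z₀) (G.utility i z₀ + G.utilityRange i) := fun h hh =>
    ⟨hπ.oppReach_nonneg i (G.mem_infoSet.1 hh).1,
      hπ.subgameValue_mem_Icc hu _ ((G.mem_avail_of_mem_infoSet hh a).1 ha)⟩
  constructor
  · refine Finset.sum_nonneg fun h hh => ?_
    rw [← mul_sub]
    exact mul_nonneg (hV h hh).1 (sub_nonneg.2 (hV h hh).2.1)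
  · calc _ ≤ ∑ h ∈ G.infoSet s, G.oppReach i π h * G.utilityRange i := by
          refine Finset.sum_le_sum fun h hh => ?_
          rw [← mul_sub]
          exact mul_le_mul_of_nonneg_left (by linarith [(hV h hh).2.2]) (hV h hh).1
      _ ≤ G.utilityRange i := by
          rw [← Finset.sum_mul]
          exact mul_le_of_le_one_left hr (hπ.sum_oppReach_le_one hG s)

variable (G)

theorem convex_simplex (s : Info) : Convex ℝ (G.simplex s) := by
  intro x hx y hy a b ha hb hab
  refine ⟨fun c => ?_, fun c hc => ?_, ?_⟩
  · simp only [PiLp.add_apply, PiLp.smul_apply, smul_eq_mul]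
    exact add_nonneg (mul_nonneg ha (hx.1 c)) (mul_nonneg hb (hy.1 c))
  · simp [hx.2.1 c hc, hy.2.1 c hc]
  · simp only [PiLp.add_apply, PiLp.smul_apply, smul_eq_mul, Finset.sum_add_distrib,
      ← Finset.mul_sum, hx.2.2, hy.2.2, mul_one, hab]

theorem norm_sub_sq_le_two (s : Info) {x y : EuclideanSpace ℝ Act} (hx : x ∈ G.simplex s)
    (hy : y ∈ G.simplex s) : ‖x - y‖ ^ 2 ≤ 2 := by
  rw [EuclideanSpace.real_norm_sq_eq]
  calc ∑ a, (x - y) a ^ 2 ≤ ∑ a, (x a + y a) := by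
        refine Finset.sum_le_sum fun a _ => ?_
        have h1 := hx.1 a
        have h2 := hy.1 a
        have h3 := G.simplex_le_one hx a
        have h4 := G.simplex_le_one hy a
        rw [PiLp.sub_apply]
        nlinarith [mul_nonneg h1 h2]
    _ = 2 := by rw [Finset.sum_add_distrib, hx.2.2, hy.2.2]; norm_num

variable {G}

/-- Along the simplex, the counterfactual values at `s` agree with a vector of squared norm at most
`|A_i| Δ²`. -/
theorem IsPolicy.exists_norm_sq_le (hG : G.PerfectRecall)
    {π : Info → EuclideanSpace ℝ Act} (hπ : G.IsPolicy π) (s : Info) :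
    ∃ g : EuclideanSpace ℝ Act,
      ‖g‖ ^ 2 ≤ G.numActions (G.player s) * G.utilityRange (G.player s) ^ 2 ∧
      ∀ v ∈ G.simplex s, ∀ w ∈ G.simplex s,
        inner ℝ (G.cfValues (G.player s) π s) (v - w) = inner ℝ g (v - w) := by
  obtain ⟨c, hc⟩ := hπ.exists_cfValues_sub_mem_Icc hG s
  refine ⟨WithLp.toLp 2 fun a => if a ∈ G.avail s then G.cfValues (G.player s) π s a - c else 0,
    ?_, fun v hv w hw => ?_⟩
  · rw [EuclideanSpace.real_norm_sq_eq]
    have hcard : (G.avail s).card ≤ G.numActions (G.player s) :=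
      Finset.le_sup (f := fun s => (G.avail s).card) (by simp)
    calc _ ≤ ∑ a, if a ∈ G.avail s then G.utilityRange (G.player s) ^ 2 else 0 := by
          refine Finset.sum_le_sum fun a _ => ?_
          simp only
          split_ifs with ha
          · exact pow_le_pow_left₀ (hc a ha).1 (hc a ha).2 2
          · simp
      _ = (G.avail s).card * G.utilityRange (G.player s) ^ 2 := by
          simp
      _ ≤ _ := mul_le_mul_of_nonneg_right (by exact_mod_cast hcard) (sq_nonneg _)
  · have h0 : ∑ a, (v a - w a) * c = 0 := by
      rw [← Finset.sum_mul, Finset.sum_sub_distrib, hv.2.2, hw.2.2, sub_self, zero_mul]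
    rw [← sub_eq_zero, ← h0]
    simp only [PiLp.inner_apply, RCLike.inner_apply, conj_trivial, PiLp.sub_apply]
    rw [← Finset.sum_sub_distrib]
    refine Finset.sum_congr rfl fun a _ => ?_
    split_ifs with ha
    · ring
    · rw [hv.2.1 a ha, hw.2.1 a ha]; ring

variable {π b : ℕ → Info → EuclideanSpace ℝ Act}

theorem IsTabularED.isPolicy {α : ℕ → ℝ} (h : G.IsTabularED α π b) (t : ℕ) :
    G.IsPolicy (π t) := by
  cases t with
  | zero => exact h.init
  | succ t => exact fun s => (h.update t s).1

/-- The regret of exploitability descent against the best responses. The factor `2` pays for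
counting the iterates `1, …, T`, which are moved with the learning rates of the rounds
`2, …, T + 1`. -/
theorem IsTabularED.sum_value_sub_le (hG : G.PerfectRecall)
    (h : G.IsTabularED (fun t => (t : ℝ) ^ (-(1 / 2) : ℝ)) π b) (i : Fin 2)
    {x : Info → EuclideanSpace ℝ Act} (hx : G.IsPolicy x) {T : ℕ} (hT : 1 ≤ T) :
    ∑ t ∈ Finset.Icc 1 T, (G.value i (G.combine i x (b (t + 1))) -
      G.value i (G.combine i (π t) (b (t + 1)))) ≤ 2 * G.regretBound i T := by
  simp only [value_combine_sub_value_combine hG]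
  rw [Finset.sum_comm]
  have hT1 : (1 : ℝ) ≤ T := by exact_mod_cast hT
  have hsqT : 1 ≤ √(T : ℝ) := Real.one_le_sqrt.2 hT1
  have hsq : √((T : ℝ) + 1) ≤ 2 * √(T : ℝ) := by
    rw [Real.sqrt_le_left (by positivity), mul_pow, Real.sq_sqrt (by positivity)]
    linarith
  have hR0 : 0 ≤ √(T : ℝ) + (√(T : ℝ) - 1 / 2) * G.numActions i * G.utilityRange i ^ 2 := by
    have : 0 ≤ √(T : ℝ) - 1 / 2 := by linarith
    positivity
  have hs : ∀ s ∈ Finset.univ.filter (fun s => G.player s = i),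
      ∑ t ∈ Finset.Icc 1 T, G.infoReach x s *
        inner ℝ (G.cfValues i (G.combine i (π t) (b (t + 1))) s) (x s - π t s) ≤
      2 * (√(T : ℝ) + (√(T : ℝ) - 1 / 2) * G.numActions i * G.utilityRange i ^ 2) := by
    intro s hs
    obtain rfl : G.player s = i := by simpa using hs
    rw [← Finset.mul_sum]
    have hK : 0 ≤ (G.numActions (G.player s) : ℝ) * G.utilityRange (G.player s) ^ 2 := by
      positivity
    have hreg := sum_inner_le_of_isProjection (G.convex_simplex s)
      (fun v hv w hw => G.norm_sub_sq_le_two s hv hw) (fun t => h.isPolicy t s)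
      (q := fun t => G.cfValues (G.player s) (G.combine (G.player s) (π t) (b (t + 1))) s)
      (fun t => h.update t s)
      (fun t => ((h.isPolicy t).combine (h.best_response t 0).1 _).exists_norm_sq_le hG s)
      (hx s) T
    refine (mul_le_mul_of_nonneg_left (hreg.trans ?_) (hx.ownReach_nonneg _ _)).trans
      (mul_le_of_le_one_left (by linarith) (hx.ownReach_le_one _ _))
    nlinarith
  refine (Finset.sum_le_card_nsmul _ _ _ hs).trans (le_of_eq ?_)
  rw [nsmul_eq_mul, regretBound, numInfo]
  ring

end Regret

end ExtensiveGame

namespace ExtensiveGame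

section Minimax

variable {Act Info : Type*} [Fintype Act] [DecidableEq Act] [Fintype Info] [DecidableEq Info]
  {G : ExtensiveGame Act Info}

/-! ### Averaging behavioral policies -/

/-- Kuhn's averaging: under perfect recall the reach probabilities contributed by a player are
averaged by the policy that weights the rows at `s` by the probability of reaching `s`. -/
theorem exists_isPolicy_average_ownReach (hG : G.PerfectRecall) {F : Finset ℕ} (hF : F.Nonempty)
    {y : ℕ → Info → EuclideanSpace ℝ Act} (hy : ∀ t ∈ F, G.IsPolicy (y t)) :
    ∃ m, G.IsPolicy m ∧ ∀ i, ∀ h ∈ G.hist,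
      F.card * G.ownReach i m h = ∑ t ∈ F, G.ownReach i (y t) h := by
  obtain ⟨t₀, ht₀⟩ := hF
  have hr : ∀ s, ∀ t ∈ F, 0 ≤ G.infoReach (y t) s := fun s t ht =>
    (hy t ht).ownReach_nonneg _ _
  let D : Info → ℝ := fun s => ∑ t ∈ F, G.infoReach (y t) s
  have hD : ∀ s, 0 ≤ D s := fun s => Finset.sum_nonneg (hr s)
  -- If no policy reaches `s`, the row at `s` is immaterial.
  let m : Info → EuclideanSpace ℝ Act := fun s =>
    if D s = 0 then y t₀ s else ∑ t ∈ F, (G.infoReach (y t) s / D s) • y t s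
  have hmD : ∀ s a, D s * m s a = ∑ t ∈ F, G.infoReach (y t) s * y t s a := by
    intro s a
    by_cases h0 : D s = 0
    · rw [h0, zero_mul, Finset.sum_eq_zero]
      intro t ht
      rw [(Finset.sum_eq_zero_iff_of_nonneg (hr s)).1 h0 t ht, zero_mul]
    · simp only [m, h0, if_false, WithLp.ofLp_sum, Finset.sum_apply, PiLp.smul_apply, smul_eq_mul,
        Finset.mul_sum]
      refine Finset.sum_congr rfl fun t _ => ?_
      field_simp
  refine ⟨m, fun s => ?_, fun i h hh => ?_⟩
  · by_cases h0 : D s = 0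
    · simpa only [m, h0, if_true] using hy t₀ ht₀ s
    · simp only [m, h0, if_false]
      refine (G.convex_simplex s).sum_mem (fun t ht => div_nonneg (hr s t ht) (hD s)) ?_
        fun t ht => hy t ht s
      rw [← Finset.sum_div]
      exact div_self h0
  · induction h with
    | nil => simp [ownReach, experience]
    | cons a h ih =>
      have hh' := G.prefix_mem a h hh
      specialize ih hh'
      cases hs : G.infoAt h with
      | none => simpa only [ownReach, G.experience_cons_none hs] using ih
      | some s =>
        by_cases hi : G.player s = i
        · subst hi
          have hmem : h ∈ G.infoSet s := G.mem_infoSet.2 ⟨hh', ⟨a, hh⟩, hs⟩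
          have hc : ∀ x : Info → EuclideanSpace ℝ Act, G.ownReach (G.player s) x (a :: h) =
              G.infoReach x s * x s a := by
            intro x
            rw [← ownReach_eq_infoReach hG x hmem, ownReach, G.experience_cons_self hs,
              List.map_cons, List.prod_cons, mul_comm]
            rfl
          simp only [ownReach_eq_infoReach hG _ hmem] at ih
          simp only [hc]
          rw [← hmD, ← mul_assoc, ih]
        · simpa only [ownReach, G.experience_cons_ne hs hi] using ih

theorem exists_isPolicy_average_value (hG : G.PerfectRecall) {F : Finset ℕ} (hF : F.Nonempty)
    {y : ℕ → Info → EuclideanSpace ℝ Act} (hy : ∀ t ∈ F, G.IsPolicy (y t)) :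
    ∃ m, G.IsPolicy m ∧ ∀ i x,
      F.card * G.value i (G.combine i x m) = ∑ t ∈ F, G.value i (G.combine i x (y t)) := by
  obtain ⟨m, hm, hav⟩ := exists_isPolicy_average_ownReach hG hF hy
  refine ⟨m, hm, fun i x => ?_⟩
  simp only [value]
  rw [Finset.sum_comm, Finset.mul_sum]
  refine Finset.sum_congr rfl fun z hz => ?_
  simp only [reach_combine, oppReach_eq]
  calc _ = G.ownReach i x z * (F.card * G.ownReach (1 - i) m z) * G.chanceReach z *
        G.utility i z := by ring
    _ = _ := by
      rw [hav _ z (G.mem_terminals.1 hz).1, Finset.mul_sum, Finset.sum_mul, Finset.sum_mul]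
      exact Finset.sum_congr rfl fun t _ => by ring

/-! ### Compactness and continuity -/

variable (G)

theorem isCompact_simplex (s : Info) : IsCompact (G.simplex s) := by
  refine Metric.isCompact_of_isClosed_isBounded ?_ ?_
  · have : G.simplex s = (⋂ a, {x | 0 ≤ x a}) ∩
        ((⋂ a, ⋂ (_ : a ∉ G.avail s), {x | x a = 0}) ∩ {x | ∑ a, x a = 1}) := by
      ext x
      simp [simplex]
    rw [this]
    refine (isClosed_iInter fun a => isClosed_le (by fun_prop) (by fun_prop)).inter
      ((isClosed_iInter fun a => isClosed_iInter fun _ =>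
        isClosed_eq (by fun_prop) (by fun_prop)).inter (isClosed_eq (by fun_prop) (by fun_prop)))
  · refine Metric.isBounded_iff.2 ⟨2, fun x hx y hy => ?_⟩
    rw [dist_eq_norm]
    nlinarith [G.norm_sub_sq_le_two s hx hy]

theorem isCompact_setOf_isPolicy : IsCompact {π | G.IsPolicy π} := by
  convert isCompact_univ_pi fun s => G.isCompact_simplex s
  ext π
  simp [IsPolicy]

theorem continuous_value (i : Fin 2) : Continuous fun π => G.value i π := by
  have h1 : ∀ h a, Continuous fun π => G.actProb π h a := by
    intro h a
    unfold actProb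
    cases G.infoAt h with
    | none => exact continuous_const
    | some s => fun_prop
  have h2 : ∀ z, Continuous fun π => G.reach π z := by
    intro z
    induction z with
    | nil => exact continuous_const
    | cons a z ih => exact ih.mul (h1 z a)
  exact continuous_finsetSum _ fun z _ => (h2 z).mul continuous_const

theorem continuous_value_combine_left (i : Fin 2) (y : Info → EuclideanSpace ℝ Act) :
    Continuous fun x => G.value i (G.combine i x y) := by
  refine (G.continuous_value i).comp (continuous_pi fun s => ?_)
  unfold combine
  split_ifs <;> fun_prop

theorem continuous_value_combine_right (i : Fin 2) (x : Info → EuclideanSpace ℝ Act) :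
    Continuous fun y => G.value i (G.combine i x y) := by
  refine (G.continuous_value i).comp (continuous_pi fun s => ?_)
  unfold combine
  split_ifs <;> fun_prop

/-! ### Equilibria of zero-sum games -/

theorem combine_one_sub (i : Fin 2) (x y : Info → EuclideanSpace ℝ Act) :
    G.combine (1 - i) x y = G.combine i y x := by
  funext s
  unfold combine
  by_cases h : G.player s = i
  · rw [if_neg ((ne_iff_eq_one_sub _ _).2 (by rw [h, sub_sub_cancel])), if_pos h]
  · rw [if_pos ((ne_iff_eq_one_sub _ _).1 h), if_neg h]

theorem combine_combine_right (i : Fin 2) (x y z : Info → EuclideanSpace ℝ Act) :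
    G.combine i x (G.combine i y z) = G.combine i x z := by
  funext s
  by_cases h : G.player s = i <;> simp [combine, h]

theorem combine_combine_left (i : Fin 2) (x y z : Info → EuclideanSpace ℝ Act) :
    G.combine i (G.combine i x y) z = G.combine i x z := by
  funext s
  by_cases h : G.player s = i <;> simp [combine, h]

variable {G}

theorem ZeroSum.value_one_sub (hz : G.ZeroSum) (i : Fin 2) (π : Info → EuclideanSpace ℝ Act) :
    G.value (1 - i) π = -G.value i π := by
  have h : G.value 0 π + G.value 1 π = 0 := by
    rw [value, value, ← Finset.sum_add_distrib]
    refine Finset.sum_eq_zero fun z hz' => ?_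
    rw [← mul_add, hz z hz', mul_zero]
  fin_cases i
  · change G.value 1 π = -G.value 0 π
    linarith
  · change G.value 0 π = -G.value 1 π
    linarith

/-- If `y` holds player `i` down to `V` and `x` guarantees player `i` at least `V - ε`, then they
form an `ε`-Nash equilibrium. -/
theorem ZeroSum.isApproxNash_combine (hz : G.ZeroSum) {i : Fin 2}
    {x y : Info → EuclideanSpace ℝ Act} {V ε : ℝ} (hx : G.IsPolicy x) (hy : G.IsPolicy y)
    (hupper : ∀ x', G.IsPolicy x' → G.value i (G.combine i x' y) ≤ V)
    (hlower : ∀ y', G.IsPolicy y' → V - ε ≤ G.value i (G.combine i x y')) :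
    G.IsApproxNash ε (G.combine i x y) := by
  have hne : {π | G.IsPolicy π}.Nonempty := ⟨x, hx⟩
  have h1 : G.exploitability i (G.combine i x y) ≤ ε := by
    have : sSup ((fun x' => G.value i (G.combine i x' (G.combine i x y))) ''
        {x' | G.IsPolicy x'}) ≤ V := by
      refine csSup_le (hne.image _) ?_
      rintro _ ⟨x', hx', rfl⟩
      simp only [combine_combine_right]
      exact hupper x' hx'
    rw [exploitability]
    linarith [hlower y hy]
  have h2 : G.exploitability (1 - i) (G.combine i x y) ≤ ε := by
    have : sSup ((fun y' => G.value (1 - i) (G.combine (1 - i) y' (G.combine i x y))) ''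
        {y' | G.IsPolicy y'}) ≤ -(V - ε) := by
      refine csSup_le (hne.image _) ?_
      rintro _ ⟨y', hy', rfl⟩
      simp only [hz.value_one_sub, combine_one_sub, combine_combine_left]
      exact neg_le_neg (hlower y' hy')
    rw [exploitability, hz.value_one_sub]
    linarith [hupper x hx]
  refine ⟨hx.combine hy i, fun j => ?_⟩
  by_cases hj : j = i
  · rwa [hj]
  · rwa [(ne_iff_eq_one_sub _ _).1 hj]

theorem IsPartOfApproxNash.mono {ε ε' : ℝ} {i : Fin 2} {π : Info → EuclideanSpace ℝ Act}
    (h : G.IsPartOfApproxNash ε i π) (hε : ε ≤ ε') : G.IsPartOfApproxNash ε' i π := by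
  obtain ⟨σ, hσ, hi⟩ := h
  exact ⟨σ, ⟨hσ.1, fun j => (hσ.2 j).trans hε⟩, hi⟩

variable (G) in
/-- `x` and `y` are optimal policies of player `i` and of the opponent, and `V` is the value of the
game for player `i`. -/
structure IsSaddle (i : Fin 2) (x y : Info → EuclideanSpace ℝ Act) (V : ℝ) : Prop where
  left_isPolicy : G.IsPolicy x
  right_isPolicy : G.IsPolicy y
  upper : ∀ x', G.IsPolicy x' → G.value i (G.combine i x' y) ≤ V
  lower : ∀ y', G.IsPolicy y' → V ≤ G.value i (G.combine i x y')

/-- Policies whose guaranteed values approach `V` approach the set of policies that guarantee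
`V`. -/
theorem eventually_exists_near_of_lower {i : Fin 2} {x : ℕ → Info → EuclideanSpace ℝ Act} {V : ℝ}
    {e : ℕ → ℝ} (hx : ∀ n, G.IsPolicy (x n)) (he : Tendsto e atTop (𝓝 0))
    (hlower : ∀ᶠ n in atTop, ∀ y, G.IsPolicy y → V - e n ≤ G.value i (G.combine i (x n) y))
    {δ : ℝ} (hδ : 0 < δ) :
    ∀ᶠ n in atTop, ∃ p, G.IsPolicy p ∧ (∀ y, G.IsPolicy y → V ≤ G.value i (G.combine i p y)) ∧
      ∀ s, ‖x n s - p s‖ < δ := by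
  by_contra hcon
  obtain ⟨φ, hφ, hfar⟩ := extraction_of_frequently_atTop (not_eventually.1 hcon)
  obtain ⟨p, hp, ψ, hψ, hlim⟩ :=
    G.isCompact_setOf_isPolicy.tendsto_subseq (x := fun n => x (φ n)) fun n => hx _
  have hsub : Tendsto (fun n => φ (ψ n)) atTop atTop := hφ.tendsto_atTop.comp hψ.tendsto_atTop
  have hpV : ∀ y, G.IsPolicy y → V ≤ G.value i (G.combine i p y) := by
    intro y hy
    have h1 : Tendsto (fun n => V - e (φ (ψ n))) atTop (𝓝 V) := by
      simpa using (he.comp hsub).const_sub V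
    have h2 := ((G.continuous_value_combine_left i y).tendsto p).comp hlim
    exact le_of_tendsto_of_tendsto h1 h2 ((hsub.eventually hlower).mono fun n hn => hn y hy)
  have hnear : ∀ᶠ n in atTop, ∀ s, ‖x (φ (ψ n)) s - p s‖ < δ := by
    refine eventually_all.2 fun s => ?_
    have h1 := (tendsto_pi_nhds.1 hlim s)
    exact (tendsto_iff_norm_sub_tendsto_zero.1 h1).eventually_lt_const hδ
  obtain ⟨n, hn⟩ := hnear.exists
  exact hfar (ψ n) ⟨p, hp, hpV, hn⟩

/-! ### The value guaranteed by the iterates of exploitability descent -/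

variable (G) in
theorem tendsto_two_mul_regretBound_div (i : Fin 2) :
    Tendsto (fun T : ℕ => 2 * G.regretBound i T / T) atTop (𝓝 0) := by
  set K : ℝ := G.numActions i * G.utilityRange i ^ 2 with hK
  have h1 : Tendsto (fun T : ℕ => 1 / √(T : ℝ)) atTop (𝓝 0) :=
    tendsto_const_nhds.div_atTop (Real.tendsto_sqrt_atTop.comp tendsto_natCast_atTop_atTop)
  have h2 : Tendsto (fun T : ℕ => 1 / (T : ℝ)) atTop (𝓝 0) :=
    tendsto_const_nhds.div_atTop tendsto_natCast_atTop_atTop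
  have h3 := ((h1.mul_const (1 + K)).sub (h2.mul_const (K / 2))).const_mul (2 * (G.numInfo i : ℝ))
  simp only [zero_mul, sub_zero, mul_zero] at h3
  refine h3.congr fun T => ?_
  rw [one_div (√(T : ℝ)), ← Real.sqrt_div_self, regretBound, mul_assoc _ (G.numActions i : ℝ), ← hK]
  ring

variable {π b : ℕ → Info → EuclideanSpace ℝ Act}

theorem IsTabularED.value_le (hz : G.ZeroSum) {α : ℕ → ℝ} (h : G.IsTabularED α π b) (i : Fin 2)
    (t : ℕ) {y : Info → EuclideanSpace ℝ Act} (hy : G.IsPolicy y) :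
    G.value i (G.combine i (π t) (b (t + 1))) ≤ G.value i (G.combine i (π t) y) := by
  have := (h.best_response t (1 - i)).2 y hy
  simp only [hz.value_one_sub, combine_one_sub] at this
  linarith

theorem IsTabularED.isPolicy_response {α : ℕ → ℝ} (h : G.IsTabularED α π b) (t : ℕ) :
    G.IsPolicy (b (t + 1)) :=
  (h.best_response t 0).1

/-- The minimax theorem, read off from a run of exploitability descent: the supremum `V` of the
values guaranteed by the iterates is guaranteed by a limit of iterates, and by the regret bound the
averages of the best responses hold player `i` down to `V` in the limit. -/
theorem IsTabularED.exists_isSaddle (hz : G.ZeroSum) (hG : G.PerfectRecall)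
    (h : G.IsTabularED (fun t => (t : ℝ) ^ (-(1 / 2) : ℝ)) π b) (i : Fin 2) :
    ∃ x y V, G.IsSaddle i x y V := by
  set w : ℕ → ℝ := fun t => G.value i (G.combine i (π t) (b (t + 1))) with hw
  have hbdd : BddAbove (Set.range w) := by
    refine (G.isCompact_setOf_isPolicy.bddAbove_image (G.continuous_value i).continuousOn).mono ?_
    rintro _ ⟨t, rfl⟩
    exact ⟨_, (h.isPolicy t).combine (h.isPolicy_response t) i, rfl⟩
  set V := ⨆ t, w t with hV
  have hwV : ∀ t, w t ≤ V := le_ciSup hbdd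
  have hlow : ∃ x, G.IsPolicy x ∧ ∀ y, G.IsPolicy y → V ≤ G.value i (G.combine i x y) := by
    have hex : ∀ n : ℕ, ∃ t, V - 1 / ((n : ℝ) + 1) < w t := fun n =>
      exists_lt_of_lt_ciSup (sub_lt_self V (by positivity))
    choose τ hτ using hex
    obtain ⟨n, p, hp, hpV, -⟩ := (eventually_exists_near_of_lower (G := G) (i := i) (V := V)
      (x := fun n => π (τ n)) (fun n => h.isPolicy _) tendsto_one_div_add_atTop_nhds_zero_nat
      (Eventually.of_forall fun n y hy => (hτ n).le.trans (h.value_le hz i _ hy))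
      one_pos).exists
    exact ⟨p, hp, hpV⟩
  have hupp : ∃ y, G.IsPolicy y ∧ ∀ x, G.IsPolicy x → G.value i (G.combine i x y) ≤ V := by
    have hex : ∀ n : ℕ, ∃ y, G.IsPolicy y ∧ ∀ x, G.IsPolicy x → G.value i (G.combine i x y) ≤
        V + 2 * G.regretBound i (n + 1) / (n + 1 : ℕ) := by
      intro n
      obtain ⟨y, hy, hav⟩ := exists_isPolicy_average_value hG (F := Finset.Icc 1 (n + 1))
        ⟨1, by simp⟩ (y := fun t => b (t + 1)) fun t _ => h.isPolicy_response t
      refine ⟨y, hy, fun x hx => ?_⟩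
      have h1 := h.sum_value_sub_le hG i hx (Nat.le_add_left 1 n)
      rw [Finset.sum_sub_distrib, ← hav i x, Nat.card_Icc, Nat.add_sub_cancel] at h1
      have h2 : ∑ t ∈ Finset.Icc 1 (n + 1), w t ≤ (n + 1 : ℕ) * V := by
        simpa using Finset.sum_le_card_nsmul (Finset.Icc 1 (n + 1)) w V fun t _ => hwV t
      have hpos : (0 : ℝ) < (n + 1 : ℕ) := by positivity
      rw [← sub_le_iff_le_add', le_div_iff₀ hpos]
      linarith
    choose y hy hyV using hex
    obtain ⟨q, hq, ψ, hψ, hlim⟩ := G.isCompact_setOf_isPolicy.tendsto_subseq hy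
    refine ⟨q, hq, fun x hx => ?_⟩
    have h1 := ((G.continuous_value_combine_right i x).tendsto q).comp hlim
    have h2 : Tendsto (fun n => V + 2 * G.regretBound i (ψ n + 1) / (ψ n + 1 : ℕ)) atTop (𝓝 V) := by
      simpa using (((G.tendsto_two_mul_regretBound_div i).comp (tendsto_add_atTop_nat 1)).comp
        hψ.tendsto_atTop).const_add V
    exact le_of_tendsto_of_tendsto' h1 h2 fun n => hyV (ψ n) x hx
  obtain ⟨x, hx, hxV⟩ := hlow
  obtain ⟨y, hy, hyV⟩ := hupp
  exact ⟨x, y, V, hx, hy, hyV, hxV⟩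

/-- By the regret bound against an optimal policy, the best iterate guarantees almost the value of
the game. -/
theorem IsTabularED.sub_le_value_of_isBestIterate (hG : G.PerfectRecall)
    (h : G.IsTabularED (fun t => (t : ℝ) ^ (-(1 / 2) : ℝ)) π b) {i : Fin 2}
    {x y : Info → EuclideanSpace ℝ Act} {V : ℝ} (hs : G.IsSaddle i x y V) {T t : ℕ} (hT : 1 ≤ T)
    (ht : G.IsBestIterate i π b T t) :
    V - 2 * G.regretBound i T / T ≤ G.value i (G.combine i (π t) (b (t + 1))) := by
  have h1 := h.sum_value_sub_le hG i hs.left_isPolicy hT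
  rw [Finset.sum_sub_distrib] at h1
  have h2 := Finset.card_nsmul_le_sum (Finset.Icc 1 T)
    (fun k => G.value i (G.combine i x (b (k + 1)))) V
    fun k _ => hs.lower _ (h.isPolicy_response k)
  have h3 := Finset.sum_le_card_nsmul (Finset.Icc 1 T)
    (fun k => G.value i (G.combine i (π k) (b (k + 1)))) _ ht.2
  simp only [Nat.card_Icc, Nat.add_sub_cancel, nsmul_eq_mul] at h2 h3
  have hpos : (0 : ℝ) < T := by exact_mod_cast hT
  rw [sub_le_iff_le_add, ← sub_le_iff_le_add', le_div_iff₀ hpos]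
  linarith

variable (G) in
theorem exists_isBestIterate (i : Fin 2) (π b : ℕ → Info → EuclideanSpace ℝ Act) {T : ℕ}
    (hT : 1 ≤ T) : ∃ t, G.IsBestIterate i π b T t :=
  (Finset.Icc 1 T).exists_max_image (fun t => G.value i (G.combine i (π t) (b (t + 1))))
    ⟨1, Finset.mem_Icc.2 ⟨le_rfl, hT⟩⟩

theorem IsTabularED.isPartOfApproxNash_of_isBestIterate (hz : G.ZeroSum) (hG : G.PerfectRecall)
    (h : G.IsTabularED (fun t => (t : ℝ) ^ (-(1 / 2) : ℝ)) π b) {i : Fin 2} {T t : ℕ}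
    (hT : 1 ≤ T) (ht : G.IsBestIterate i π b T t) :
    G.IsPartOfApproxNash (2 * G.regretBound i T / T) i (π t) := by
  obtain ⟨x, y, V, hs⟩ := h.exists_isSaddle hz hG i
  refine ⟨G.combine i (π t) y, hz.isApproxNash_combine (h.isPolicy t) hs.right_isPolicy hs.upper
    fun y' hy' => ?_, fun s hi => by simp [combine, hi]⟩
  exact (h.sub_le_value_of_isBestIterate hG hs hT ht).trans (h.value_le hz i t hy')

/-! ### Exploitability descent as CFR-BR with gradient ascent -/

theorem gradient_neg_sum_mul (c x : EuclideanSpace ℝ Act) :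
    gradient (fun x : EuclideanSpace ℝ Act => -∑ a, x a * c a) x = -c := by
  refine HasGradientAt.gradient ?_
  have he : (fun x : EuclideanSpace ℝ Act => -∑ a, x a * c a) =
      ⇑(InnerProductSpace.toDual ℝ (EuclideanSpace ℝ Act) (-c)) := by
    funext x
    simp [PiLp.inner_apply]
  rw [he]
  exact ContinuousLinearMap.hasFDerivAt _

variable (G) in
theorem isTabularED_iff_isCFRBR (α : ℕ → ℝ) (π b : ℕ → Info → EuclideanSpace ℝ Act) :
    G.IsTabularED α π b ↔ G.IsCFRBR (IsGIGA α) (fun t => π (t - 1)) b := by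
  constructor
  · intro h
    refine ⟨fun t ht i => ?_, fun s => ⟨h.init s, fun t ht => ?_⟩⟩
    · obtain ⟨t, rfl⟩ := Nat.exists_eq_add_of_le' ht
      exact h.best_response t i
    · obtain ⟨t, rfl⟩ := Nat.exists_eq_add_of_le' ht
      simp only [gradient_neg_sum_mul, smul_neg, sub_neg_eq_add, Nat.add_sub_cancel]
      exact h.update t s
  · intro h
    refine ⟨fun s => (h.local_learner s).1, fun t i => h.best_response (t + 1) (by omega) i,
      fun t s => ?_⟩
    have := (h.local_learner s).2 (t + 1) (by omega)
    simpa only [gradient_neg_sum_mul, smul_neg, sub_neg_eq_add, Nat.add_sub_cancel] using this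

end Minimax

end ExtensiveGame

theorem mainTheorem2 {Act Info : Type*} [Fintype Act] [DecidableEq Act] [Fintype Info]
    [DecidableEq Info] (G : ExtensiveGame Act Info) (hzero : G.ZeroSum)
    (hrecall : G.PerfectRecall) :
    -- TabularED(q^c, ℓ₂) coincides with CFR-BR(GIGA); its round `t` plays the ED iterate `t - 1`
    (∀ (α : ℕ → ℝ) (π b : ℕ → Info → EuclideanSpace ℝ Act),
      G.IsTabularED α π b ↔ G.IsCFRBR (IsGIGA α) (fun t => π (t - 1)) b) ∧
    (∀ π b : ℕ → Info → EuclideanSpace ℝ Act,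
      G.IsTabularED (fun t => (t : ℝ) ^ (-(1 / 2) : ℝ)) π b → ∀ i : Fin 2,
      -- the bound for some iterate, and for the best iterate
      (∀ T : ℕ, 1 ≤ T → ∃ t ∈ Finset.Icc 1 T,
        G.IsPartOfApproxNash (2 * G.regretBound i T / T) i (π t)) ∧
      (∀ T : ℕ, 1 ≤ T → ∀ t, G.IsBestIterate i π b T t →
        G.IsPartOfApproxNash (2 * G.regretBound i T / T) i (π t)) ∧
      -- convergence of the best iterate to equilibrium
      Tendsto (fun T : ℕ => 2 * G.regretBound i T / T) atTop (𝓝 0) ∧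
      (∀ best : ℕ → ℕ, (∀ T, 1 ≤ T → G.IsBestIterate i π b T (best T)) →
        (∀ δ : ℝ, 0 < δ → ∀ᶠ T in atTop, G.IsPartOfApproxNash δ i (π (best T))) ∧
        (∀ δ : ℝ, 0 < δ → ∀ᶠ T in atTop, ∃ σ, G.IsApproxNash 0 σ ∧
          ∀ s, G.player s = i → ‖π (best T) s - σ s‖ < δ))) := by
  refine ⟨G.isTabularED_iff_isCFRBR, fun π b h i => ?_⟩
  have hbest : ∀ T : ℕ, 1 ≤ T → ∀ t, G.IsBestIterate i π b T t →
      G.IsPartOfApproxNash (2 * G.regretBound i T / T) i (π t) := fun T hT t ht =>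
    h.isPartOfApproxNash_of_isBestIterate hzero hrecall hT ht
  have hlim := G.tendsto_two_mul_regretBound_div i
  refine ⟨fun T hT => ?_, hbest, hlim, fun best hb => ⟨fun δ hδ => ?_, fun δ hδ => ?_⟩⟩
  · obtain ⟨t, ht⟩ := G.exists_isBestIterate i π b hT
    exact ⟨t, ht.1, hbest T hT t ht⟩
  · filter_upwards [eventually_ge_atTop 1, hlim.eventually_le_const hδ] with T hT hTδ
    exact (hbest T hT _ (hb T hT)).mono hTδ
  · obtain ⟨x, y, V, hs⟩ := h.exists_isSaddle hzero hrecall i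
    have hlower : ∀ᶠ T : ℕ in atTop, ∀ y', G.IsPolicy y' →
        V - 2 * G.regretBound i T / T ≤ G.value i (G.combine i (π (best T)) y') := by
      filter_upwards [eventually_ge_atTop 1] with T hT y' hy'
      exact (h.sub_le_value_of_isBestIterate hrecall hs hT (hb T hT)).trans
        (h.value_le hzero i _ hy')
    filter_upwards [ExtensiveGame.eventually_exists_near_of_lower (fun T => h.isPolicy (best T))
      hlim hlower hδ] with T ⟨p, hp, hpV, hnear⟩
    refine ⟨G.combine i p y, hzero.isApproxNash_combine hp hs.right_isPolicy hs.upper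
      fun y' hy' => by simpa using hpV y' hy', fun s hi => ?_⟩
    simpa [ExtensiveGame.combine, hi] using hnear s
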